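/- Let $n\ge 1$. For $t\ge 1$ let $A_t=(a_{ij}(t))$ be a row-stochastic $n\times n$ matrix (nonnegative entries, rows summing to one), let $\mathcal E_t=\mathrm{diag}(\epsilon_1(t),\dots,\epsilon_n(t))$ with real $\epsilon_i(t)$, and let $\bar\sigma\in\mathbb R$, identified with the vector $\bar\sigma\mathbf 1\in\mathbb R^n$. Write $|v|_\infty=\max_i|v_i|$ for vectors and $|B|_\infty=\max_i\sum_j|b_{ij}|$ for matrices. Let $X_0$ and $\gamma_1,\gamma_2,\dots$ be random vectors in $\mathbb R^n$ on a common probability space, and define $$X_t=A_tX_{t-1}+\mathcal E_t(\bar\sigma+\gamma_t-X_{t-1}),\qquad t\ge 1.$$ Put $\rho_t=\max_{i}\big(|a_{ii}(t)-\epsilon_i(t)|+1-a_{ii}(t)\big)$ and consider the conditions $$\text{(a)}\quad \sup_{t\ge1}\{\rho_t+\rho_t\rho_{t-1}+\dots+\rho_t\rho_{t-1}\cdots\rho_1\}<\infty,\qquad \text{(b)}\quad \sum_{t\ge1}\big(|A_t-A_{t-1}|_\infty+|\mathcal E_t-\mathcal E_{t-1}|_\infty\big)<\infty$$ (in (b),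 $A_0$ and $\mathcal E_0$ are arbitrary; they do not affect the condition). Assume (a) in parts (1)–(4). 1. If $\gamma_t\to0$ almost surely, then $X_t\to\bar\sigma$ almost surely. 2. If $\gamma_t\to0$ in probability and $\sup_{t\ge1}|\gamma_t|_\infty<\infty$ almost surely, then $X_t\to\bar\sigma$ in probability. 3. Let $1\le p\le\infty$. If $X_0\in L^p$, $\gamma_t\in L^p$ for all $t\ge 1$, and $\gamma_t\to0$ in $L^p$, then $X_t\in L^p$ for all $t$ and $X_t\to\bar\sigma$ in $L^p$. 4. If $(\gamma_t)_{t\ge1}$ are independent, identically distributed and integrable, and (b) holds, then $X_t$ converges in distribution as $t\to\infty$, that is, the laws of $X_t$ converge weakly to a probability measure on $\mathbb R^n$. 5. Without condition (b), the conclusion of (4) can fail for all non-constant integrable noise: for every $n\ge1$ there are row-stochastic matrices $A_t$ and diagonal matrices $\mathcal E_t$ that satisfy (a) but not (b) such that, whenever $(\gamma_t)_{t\ge1}$ are independent, identically distributed, integrable and $\gamma_1$ is not almost surely constant, then for every $\bar\sigma$ and every initial random vector $X_0$ the sequence $X_t$ does not converge in distribution. -/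

import Mathlib

open MeasureTheory ProbabilityTheory Filter Topology Set

universe u

-- The norm on matrices is the largest absolute row sum, `|B|_∞ = max_i ∑_j |b_ij|`.
attribute [local instance] Matrix.linftyOpNormedAddCommGroup

/-- The contraction coefficient `max_i (|a_ii - ε_i| + 1 - a_ii)` of a weight matrix with entries
`a_ij` and learning rates `ε_i`. -/
noncomputable def contractionCoeff {n : ℕ} (A : Matrix (Fin n) (Fin n) ℝ) (ε : Fin n → ℝ) : ℝ :=
  ⨆ i, (|A i i - ε i| + 1 - A i i)

/-- With `ρ_t` the contraction coefficient at time `t ≥ 1`, this is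
`sup_{t ≥ 1} (ρ_t + ρ_t ρ_{t-1} + ⋯ + ρ_t ρ_{t-1} ⋯ ρ_1) < ∞`. -/
def BoundedContraction {n : ℕ} (A : ℕ → Matrix (Fin n) (Fin n) ℝ) (ε : ℕ → Fin n → ℝ) : Prop :=
  BddAbove {S : ℝ | ∃ t : ℕ, 1 ≤ t ∧
    S = ∑ s ∈ Finset.Icc 1 t, ∏ j ∈ Finset.Icc s t, contractionCoeff (A j) (ε j)}

/-- `∑_{t ≥ 1} (|A_t - A_{t-1}|_∞ + |𝓔_t - 𝓔_{t-1}|_∞) < ∞`, where `𝓔_t = diag(ε_t)`. -/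
def SummableVariation {n : ℕ} (A : ℕ → Matrix (Fin n) (Fin n) ℝ) (ε : ℕ → Fin n → ℝ) : Prop :=
  Summable fun t : ℕ =>
    ‖A (t + 1) - A t‖ + ‖Matrix.diagonal (ε (t + 1)) - Matrix.diagonal (ε t)‖

/-- The opinions `X_t` satisfy `X_t = A_t X_{t-1} + 𝓔_t (σ 1 + γ_t - X_{t-1})` for all `t ≥ 1`,
where `𝓔_t = diag(ε_t)`, each `A_t` is row-stochastic, and the initial opinion `X_0` and the noises
`γ_t`, `t ≥ 1`, are random vectors. Values `A_0`, `ε_0`, `γ_0` play no role. -/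
structure IsNoisyLearning {n : ℕ} {Ω : Type*} [MeasurableSpace Ω]
    (A : ℕ → Matrix (Fin n) (Fin n) ℝ) (ε : ℕ → Fin n → ℝ) (σ : ℝ)
    (γ X : ℕ → Ω → Fin n → ℝ) : Prop where
  stochastic : ∀ t, 1 ≤ t → A t ∈ Matrix.rowStochastic ℝ (Fin n)
  measurable_initial : Measurable (X 0)
  measurable_noise : ∀ t, 1 ≤ t → Measurable (γ t)
  recursion : ∀ t ω, X (t + 1) ω = (A (t + 1)).mulVec (X t ω) +
    (Matrix.diagonal (ε (t + 1))).mulVec ((fun _ => σ) + γ (t + 1) ω - X t ω)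

/-- The random vectors `γ_t`, `t ≥ 1`, are independent, identically distributed and integrable. -/
structure IsIIDIntegrable {n : ℕ} {Ω : Type*} [MeasurableSpace Ω] (P : Measure Ω)
    (γ : ℕ → Ω → Fin n → ℝ) : Prop where
  indep : iIndepFun (fun t : ℕ => γ (t + 1)) P
  ident : ∀ t, 1 ≤ t → IdentDistrib (γ t) (γ 1) P P
  integrable : Integrable (γ 1) P

/-- The laws of the `X_t` converge weakly to some probability measure on `ℝⁿ`. -/
def ConvergesInDistribution {n : ℕ} {Ω : Type*} [MeasurableSpace Ω] (P : Measure Ω)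
    [IsProbabilityMeasure P] (X : ℕ → Ω → Fin n → ℝ) : Prop :=
  ∃ ν : ProbabilityMeasure (Fin n → ℝ),
    TendstoInDistribution X atTop id (fun _ => P) (ν : Measure (Fin n → ℝ))

/-! ### Real recursions -/

/-! The deviation `X t - σ` is multiplied by `A t - diagonal (ε t)` and forced by `diagonal (ε t)`
applied to `γ t`. Row-stochasticity makes the maximal row sum norm of that matrix exactly ρ_t
(`norm_sub_diagonal`). A single ρ_t may exceed 1, but condition (a) gives bounded weights in which
every step contracts by one fixed θ < 1 (`exists_contracting_weights`). Vanishing forcing then gives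
vanishing deviation, path by path or, by Minkowski, in L^p norm. In probability, a deviation above δ
needs either large noise now or an earlier deviation above κδ with κ > 1; iterating pushes the level
beyond an almost sure bound (`tendsto_measure_of_recursion`).

For iid noise, (b) makes the coefficients converge, and (a) forces the limit matrix B to have norm
below 1. The autoregression with constant coefficients has the law of a time-reversed sum that
converges almost surely. Started at σ, the process differs from it, shifted by σ, by an L^1-null
term; two solutions with the same noise merge, so the initial vector is irrelevant.

For the counterexample, A = 1 and the rates alternate between 1 and 2. The laws at even and odd
times are those of σ + γ_1 and σ + 2γ_2 - γ_1. If they agree, centring and comparing first absolute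
moments force constant noise. -/

theorem le_geometric_of_recursion {θ b : ℝ} {y : ℕ → ℝ} (hθ : 0 ≤ θ) (hb : 0 ≤ b)
    (h : ∀ t, y (t + 1) ≤ θ * y t + (1 - θ) * b) (k : ℕ) : y k ≤ θ ^ k * y 0 + b := by
  induction k with
  | zero => simpa using hb
  | succ k ih =>
    calc y (k + 1) ≤ θ * y k + (1 - θ) * b := h k
      _ ≤ θ * (θ ^ k * y 0 + b) + (1 - θ) * b := by gcongr
      _ = θ ^ (k + 1) * y 0 + b := by ring

theorem tendsto_zero_of_recursion {θ : ℝ} {y c : ℕ → ℝ} (hθ : 0 ≤ θ) (hθ1 : θ < 1)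
    (hy : ∀ t, 0 ≤ y t) (h : ∀ t, y (t + 1) ≤ θ * y t + c t) (hc : Tendsto c atTop (𝓝 0)) :
    Tendsto y atTop (𝓝 0) := by
  rw [Metric.tendsto_atTop]
  intro δ hδ
  -- Forcing below (1 - θ)δ/2 has fixed point δ/2; the other half of δ absorbs the geometric memory
  -- of y_N.
  obtain ⟨N, hN⟩ := eventually_atTop.1
    (hc.eventually (gt_mem_nhds (by nlinarith : (0 : ℝ) < (1 - θ) * (δ / 2))))
  have hpow : Tendsto (fun k : ℕ => θ ^ k * y N) atTop (𝓝 0) := by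
    simpa using (tendsto_pow_atTop_nhds_zero_of_lt_one hθ hθ1).mul_const (y N)
  obtain ⟨K, hK⟩ := eventually_atTop.1 (hpow.eventually (gt_mem_nhds (half_pos hδ)))
  refine ⟨N + K, fun t ht => ?_⟩
  obtain ⟨k, rfl⟩ := Nat.exists_eq_add_of_le (show N ≤ t by omega)
  have h1 := le_geometric_of_recursion (y := fun j => y (N + j)) hθ (half_pos hδ).le
    (fun j => (h (N + j)).trans (by gcongr; exact (hN (N + j) (by omega)).le)) k
  have h2 := hK k (by omega)
  rw [Real.dist_eq, sub_zero, abs_of_nonneg (hy _)]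
  simp only [add_zero] at h1
  linarith

/-- The condition on partial sums of products supplies weights `w`, bounded above and below, with
respect to which the recursion contracts at a uniform rate. -/
theorem exists_contracting_weights {ρ : ℕ → ℝ} (hρ : ∀ t, 1 ≤ t → 0 ≤ ρ t)
    (h : BddAbove {S : ℝ | ∃ t : ℕ, 1 ≤ t ∧
      S = ∑ s ∈ Finset.Icc 1 t, ∏ j ∈ Finset.Icc s t, ρ j}) :
    ∃ (w : ℕ → ℝ) (θ W : ℝ), 0 < θ ∧ θ < 1 ∧ (∀ t, 1 ≤ w t) ∧ (∀ t, w t ≤ W) ∧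
      ∀ t, ρ (t + 1) * w t ≤ θ * w (t + 1) := by
  obtain ⟨M, hM⟩ := h
  set S : ℕ → ℝ := fun t => ∑ s ∈ Finset.Icc 1 t, ∏ j ∈ Finset.Icc s t, ρ j with hS
  have hS0 : ∀ t, 0 ≤ S t := fun t => Finset.sum_nonneg fun s hs => Finset.prod_nonneg fun j hj =>
    hρ j ((Finset.mem_Icc.1 hs).1.trans (Finset.mem_Icc.1 hj).1)
  -- The maximum with 1 keeps the bound positive, so that θ = K/(1 + K) is positive. The empty sum S
  -- 0 = 0 lies outside the range of `hM`.
  have hSM : ∀ t, S t ≤ max M 1 := by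
    intro t
    rcases Nat.eq_zero_or_pos t with rfl | ht
    · simp [hS]
    · exact (hM ⟨t, ht, rfl⟩).trans (le_max_left _ _)
  have hrec : ∀ t, S (t + 1) = ρ (t + 1) * (1 + S t) := by
    intro t
    simp only [hS]
    rw [Finset.sum_Icc_succ_top (by omega), Finset.Icc_self, Finset.prod_singleton, mul_add,
      mul_one, Finset.mul_sum, add_comm]
    congr 1
    refine Finset.sum_congr rfl fun s hs => ?_
    rw [Finset.prod_Icc_succ_top (by have := (Finset.mem_Icc.1 hs).2; omega), mul_comm]
  set K := max M 1
  have hK : 1 ≤ K := le_max_right _ _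
  -- With w = 1 + S the recursion reads ρ_{t+1} w_t = S_{t+1}, and S ≤ K is equivalent to S ≤ K/(1 +
  -- K) · (1 + S).
  refine ⟨fun t => 1 + S t, K / (1 + K), 1 + K, by positivity, ?_, fun t => by linarith [hS0 t],
    fun t => by linarith [hSM t], fun t => ?_⟩
  · rw [div_lt_one (by positivity)]; linarith
  · rw [← hrec, div_mul_eq_mul_div, le_div_iff₀ (by positivity)]
    nlinarith [hSM (t + 1)]

theorem div_weight_recursion {ρ w y c : ℕ → ℝ} {θ : ℝ} (hw : ∀ t, 1 ≤ w t)
    (hρ : ∀ t, ρ (t + 1) * w t ≤ θ * w (t + 1)) (hy : ∀ t, 0 ≤ y t) (hc : ∀ t, 0 ≤ c t)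
    (h : ∀ t, y (t + 1) ≤ ρ (t + 1) * y t + c t) (t : ℕ) :
    y (t + 1) / w (t + 1) ≤ θ * (y t / w t) + c t := by
  have hw0 : 0 < w t := by linarith [hw t]
  have hw1 : 0 < w (t + 1) := by linarith [hw (t + 1)]
  rw [div_le_iff₀ hw1]
  have h1 : c t ≤ c t * w (t + 1) := le_mul_of_one_le_right (hc t) (hw _)
  have h2 : ρ (t + 1) * y t ≤ θ * w (t + 1) * (y t / w t) := by
    calc ρ (t + 1) * y t = ρ (t + 1) * w t * (y t / w t) := by field_simp
      _ ≤ _ := by exact mul_le_mul_of_nonneg_right (hρ t) (div_nonneg (hy t) hw0.le)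
  linarith [h t]

theorem tendsto_zero_of_weighted_recursion {ρ w y c : ℕ → ℝ} {θ W : ℝ} (hθ : 0 < θ) (hθ1 : θ < 1)
    (hw : ∀ t, 1 ≤ w t) (hW : ∀ t, w t ≤ W) (hρ : ∀ t, ρ (t + 1) * w t ≤ θ * w (t + 1))
    (hy : ∀ t, 0 ≤ y t) (hc : ∀ t, 0 ≤ c t) (h : ∀ t, y (t + 1) ≤ ρ (t + 1) * y t + c t)
    (hc0 : Tendsto c atTop (𝓝 0)) : Tendsto y atTop (𝓝 0) := by
  have hw0 : ∀ t, 0 < w t := fun t => by linarith [hw t]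
  have h1 := tendsto_zero_of_recursion hθ.le hθ1 (fun t => div_nonneg (hy t) (hw0 t).le)
    (div_weight_recursion hw hρ hy hc h) hc0
  refine squeeze_zero hy (fun t => ?_) (by simpa using h1.const_mul W)
  calc y t = w t * (y t / w t) := by field_simp [(hw0 t).ne']
    _ ≤ W * (y t / w t) := by gcongr; exacts [div_nonneg (hy t) (hw0 t).le, hW t]

/-- If r ≥ 1, then eventually ρ exceeds q = (1 + θ)/2 > θ, so the weights must grow at least like
(q/θ)^k, against their bound W. -/
theorem lt_one_of_tendsto_of_weights {ρ w : ℕ → ℝ} {θ W r : ℝ} (hθ : 0 < θ) (hθ1 : θ < 1)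
    (hw : ∀ t, 1 ≤ w t) (hW : ∀ t, w t ≤ W) (hρ : ∀ t, ρ (t + 1) * w t ≤ θ * w (t + 1))
    (hr : Tendsto ρ atTop (𝓝 r)) : r < 1 := by
  by_contra! hr1
  obtain ⟨N, hN⟩ := eventually_atTop.1
    (hr.eventually (lt_mem_nhds (by linarith : (1 + θ) / 2 < r)))
  set q := (1 + θ) / 2 with hq
  have hq0 : 0 < q := by positivity
  have key : ∀ k, q ^ k ≤ θ ^ k * w (N + k) := by
    intro k
    induction k with
    | zero => simpa using hw N
    | succ k ih =>
      have hk : q * w (N + k) ≤ θ * w (N + k + 1) :=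
        le_trans (by gcongr; exacts [zero_le_one.trans (hw _), (hN _ (by omega)).le]) (hρ (N + k))
      calc q ^ (k + 1) = q * q ^ k := pow_succ' _ _
        _ ≤ q * (θ ^ k * w (N + k)) := by gcongr
        _ = θ ^ k * (q * w (N + k)) := by ring
        _ ≤ θ ^ k * (θ * w (N + k + 1)) := by gcongr
        _ = θ ^ (k + 1) * w (N + (k + 1)) := by rw [← add_assoc]; ring
  have hlim : Tendsto (fun k : ℕ => (θ / q) ^ k * W) atTop (𝓝 0) := by
    simpa using (tendsto_pow_atTop_nhds_zero_of_lt_one (div_pos hθ hq0).le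
      ((div_lt_one hq0).2 (by linarith))).mul_const W
  refine absurd (ge_of_tendsto' hlim fun k => ?_) (by norm_num : ¬ (1 : ℝ) ≤ 0)
  rw [div_pow, div_mul_eq_mul_div, one_le_div (by positivity)]
  exact (key k).trans (by gcongr; exact hW _)

/-! ### The contraction coefficient as a matrix norm -/

section Coefficient

variable {n : ℕ} {A : Matrix (Fin n) (Fin n) ℝ} {ε : Fin n → ℝ}

/-- Off the diagonal the entries are those of A, nonnegative with sum 1 - a_ii. -/
theorem sum_norm_sub_diagonal (hA : A ∈ Matrix.rowStochastic ℝ (Fin n)) (i : Fin n) :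
    ∑ j, ‖(A - Matrix.diagonal ε) i j‖ = |A i i - ε i| + 1 - A i i := by
  have h1 := Matrix.sum_row_of_mem_rowStochastic hA i
  rw [← Finset.add_sum_erase _ _ (Finset.mem_univ i)] at h1 ⊢
  have h2 : ∑ j ∈ Finset.univ.erase i, ‖(A - Matrix.diagonal ε) i j‖ =
      ∑ j ∈ Finset.univ.erase i, A i j := by
    refine Finset.sum_congr rfl fun j hj => ?_
    rw [Matrix.sub_apply, Matrix.diagonal_apply_ne' _ (Finset.ne_of_mem_erase hj), sub_zero,
      Real.norm_of_nonneg (hA.1 i j)]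
  rw [h2, Matrix.sub_apply, Matrix.diagonal_apply_eq, Real.norm_eq_abs]
  linarith

theorem norm_sub_diagonal (hA : A ∈ Matrix.rowStochastic ℝ (Fin n)) :
    ‖A - Matrix.diagonal ε‖ = contractionCoeff A ε := by
  rw [Matrix.linfty_opNorm_def, contractionCoeff]
  simp_rw [← sum_norm_sub_diagonal hA]
  rcases isEmpty_or_nonempty (Fin n) with h | h
  · simp [Real.iSup_of_isEmpty]
  · rw [← Finset.sup'_eq_sup Finset.univ_nonempty, Finset.sup'_univ_eq_ciSup, NNReal.coe_iSup]
    simp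

theorem norm_diagonal_le (hA : A ∈ Matrix.rowStochastic ℝ (Fin n)) :
    ‖Matrix.diagonal ε‖ ≤ contractionCoeff A ε + 1 := by
  have h1 : ‖A‖ ≤ 1 := by
    rw [Matrix.linfty_opNorm_def, ← NNReal.coe_one, NNReal.coe_le_coe]
    refine Finset.sup_le fun i _ => ?_
    have h2 : ∑ j, ‖A i j‖ = 1 := (Finset.sum_congr rfl fun j _ =>
      Real.norm_of_nonneg (hA.1 i j)).trans (Matrix.sum_row_of_mem_rowStochastic hA i)
    rw [← NNReal.coe_le_coe, NNReal.coe_sum, NNReal.coe_one]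
    exact h2.le
  calc ‖Matrix.diagonal ε‖ = ‖A - (A - Matrix.diagonal ε)‖ := by rw [sub_sub_cancel]
    _ ≤ ‖A‖ + ‖A - Matrix.diagonal ε‖ := norm_sub_le _ _
    _ ≤ contractionCoeff A ε + 1 := by rw [norm_sub_diagonal hA]; linarith

end Coefficient

/-! ### Norm estimates for random vectors -/

section Estimates

variable {Ω E F G : Type*} [MeasurableSpace Ω] [NormedAddCommGroup E] [NormedAddCommGroup F]
  [NormedAddCommGroup G] {P : Measure Ω}

/-- Minkowski's inequality, in the form that turns a pointwise recursion into a real recursion for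
L^p norms. -/
theorem MeasureTheory.MemLp.of_norm_le_add {p : ENNReal} (hp : 1 ≤ p) {f : Ω → E} {g : Ω → F}
    {h : Ω → G} {a b : ℝ} (ha : 0 ≤ a) (hb : 0 ≤ b) (hf : AEStronglyMeasurable f P)
    (hg : MemLp g p P) (hh : MemLp h p P) (hle : ∀ ω, ‖f ω‖ ≤ a * ‖g ω‖ + b * ‖h ω‖) :
    MemLp f p P ∧ (eLpNorm f p P).toReal ≤
      a * (eLpNorm g p P).toReal + b * (eLpNorm h p P).toReal := by
  have hg' : MemLp (fun ω => a * ‖g ω‖) p P := hg.norm.const_mul a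
  have hh' : MemLp (fun ω => b * ‖h ω‖) p P := hh.norm.const_mul b
  have hle' : eLpNorm f p P ≤ ENNReal.ofReal a * eLpNorm g p P +
      ENNReal.ofReal b * eLpNorm h p P := by
    calc eLpNorm f p P ≤ eLpNorm ((fun ω => a * ‖g ω‖) + fun ω => b * ‖h ω‖) p P :=
          eLpNorm_mono_real hle
      _ ≤ eLpNorm (fun ω => a * ‖g ω‖) p P + eLpNorm (fun ω => b * ‖h ω‖) p P :=
          eLpNorm_add_le hg'.1 hh'.1 hp
      _ = _ := by
          rw [show (fun ω => a * ‖g ω‖) = a • fun ω => ‖g ω‖ from rfl,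
            show (fun ω => b * ‖h ω‖) = b • fun ω => ‖h ω‖ from rfl, eLpNorm_const_smul,
            eLpNorm_const_smul, eLpNorm_norm, eLpNorm_norm, Real.enorm_of_nonneg ha,
            Real.enorm_of_nonneg hb]
  have hfin : ENNReal.ofReal a * eLpNorm g p P + ENNReal.ofReal b * eLpNorm h p P ≠ ⊤ :=
    ENNReal.add_ne_top.2 ⟨ENNReal.mul_ne_top ENNReal.ofReal_ne_top hg.eLpNorm_ne_top,
      ENNReal.mul_ne_top ENNReal.ofReal_ne_top hh.eLpNorm_ne_top⟩
  refine ⟨⟨hf, hle'.trans_lt hfin.lt_top⟩, (ENNReal.toReal_mono hfin hle').trans_eq ?_⟩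
  rw [ENNReal.toReal_add (ENNReal.mul_ne_top ENNReal.ofReal_ne_top hg.eLpNorm_ne_top)
    (ENNReal.mul_ne_top ENNReal.ofReal_ne_top hh.eLpNorm_ne_top), ENNReal.toReal_mul,
    ENNReal.toReal_mul, ENNReal.toReal_ofReal ha, ENNReal.toReal_ofReal hb]

end Estimates

/-- A contracting recursion whose noise tends to zero in probability, and whose solution is almost
surely bounded, tends to zero in probability. -/
theorem tendsto_measure_of_recursion {Ω : Type*} [MeasurableSpace Ω] {P : Measure Ω}
    [IsProbabilityMeasure P] {θ : ℝ} {y c : ℕ → Ω → ℝ} (hθ : 0 < θ) (hθ1 : θ < 1)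
    (hym : ∀ t, Measurable (y t)) (h : ∀ t ω, y (t + 1) ω ≤ θ * y t ω + c t ω)
    (hc : ∀ δ > 0, Tendsto (fun t => P {ω | δ ≤ c t ω}) atTop (𝓝 0))
    (hbdd : ∀ᵐ ω ∂P, ∃ b, ∀ t, y t ω ≤ b) {δ : ℝ} (hδ : 0 < δ) :
    Tendsto (fun t => P {ω | δ ≤ y t ω}) atTop (𝓝 0) := by
  -- Chosen so that θκ = (1 + θ)/2, which leaves (1 - θ)/2 of the level δ for the noise while κ > 1.
  set κ : ℝ := (1 + θ) / (2 * θ) with hκ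
  have hκ1 : 1 < κ := by rw [hκ, one_lt_div (by positivity)]; linarith
  have hstep : ∀ δ > 0, limsup (fun t => P {ω | δ ≤ y t ω}) atTop ≤
      limsup (fun t => P {ω | κ * δ ≤ y t ω}) atTop := by
    intro δ hδ
    have hδ' : 0 < (1 - θ) / 2 * δ := by have := sub_pos.2 hθ1; positivity
    rw [← limsup_nat_add _ 1]
    calc limsup (fun t => P {ω | δ ≤ y (t + 1) ω}) atTop
        ≤ limsup ((fun t => P {ω | κ * δ ≤ y t ω}) +
            fun t => P {ω | (1 - θ) / 2 * δ ≤ c t ω}) atTop := by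
          refine limsup_le_limsup (Eventually.of_forall fun t => ?_)
          refine (measure_mono fun ω hω => ?_).trans (measure_union_le _ _)
          simp only [mem_union, mem_ofPred_eq] at hω ⊢
          by_contra! hcon
          have h1 : θ * y t ω < θ * (κ * δ) := mul_lt_mul_of_pos_left hcon.1 hθ
          have h2 : θ * (κ * δ) = (1 + θ) / 2 * δ := by rw [hκ]; field_simp
          linarith [h t ω]
      _ = _ := ENNReal.limsup_add_of_right_tendsto_zero (hc _ hδ') _
  have hiter : ∀ N : ℕ, limsup (fun t => P {ω | δ ≤ y t ω}) atTop ≤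
      limsup (fun t => P {ω | κ ^ N * δ ≤ y t ω}) atTop := by
    intro N
    induction N with
    | zero => simp
    | succ N ih =>
      refine ih.trans ((hstep _ (by positivity)).trans_eq ?_)
      simp_rw [pow_succ', mul_assoc]
  have hsup : ∀ N : ℕ, limsup (fun t => P {ω | δ ≤ y t ω}) atTop ≤
      P (⋃ t, {ω | κ ^ N * δ ≤ y t ω}) := fun N =>
    (hiter N).trans (limsup_le_of_le (by isBoundedDefault)
      (Eventually.of_forall fun t => measure_mono (subset_iUnion (fun t => {ω | κ ^ N * δ ≤ y t ω}) t)))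
  have hpow : Tendsto (fun N : ℕ => κ ^ N * δ) atTop atTop :=
    (tendsto_pow_atTop_atTop_of_one_lt hκ1).atTop_mul_const hδ
  have hzero : Tendsto (fun N : ℕ => P (⋃ t, {ω | κ ^ N * δ ≤ y t ω})) atTop (𝓝 0) := by
    -- On this intersection the path exceeds every level κ^N δ, hence is unbounded.
    have hnull : P (⋂ N : ℕ, ⋃ t, {ω | κ ^ N * δ ≤ y t ω}) = 0 := by
      refine measure_mono_null (fun ω hω => ?_) (ae_iff.1 hbdd)
      simp only [mem_iInter, mem_iUnion, mem_ofPred_eq] at hω ⊢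
      rintro ⟨b, hb⟩
      obtain ⟨N, hN⟩ := (hpow.eventually_gt_atTop b).exists
      obtain ⟨t, ht⟩ := hω N
      linarith [hb t]
    rw [← hnull]
    refine tendsto_measure_iInter_atTop
      (fun N => (MeasurableSet.iUnion fun t =>
        measurableSet_le measurable_const (hym t)).nullMeasurableSet) ?_ ⟨0, measure_ne_top _ _⟩
    intro N M hNM
    have := pow_le_pow_right₀ hκ1.le hNM
    exact iUnion_mono fun t ω (hω : κ ^ M * δ ≤ y t ω) =>
      show κ ^ N * δ ≤ y t ω from le_trans (by gcongr) hω
  have hlim : limsup (fun t => P {ω | δ ≤ y t ω}) atTop ≤ 0 := ge_of_tendsto' hzero hsup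
  exact tendsto_of_le_liminf_of_limsup_le bot_le hlim

/-! ### The deviation from the true state -/

section Deviation

variable {n : ℕ} {Ω : Type*} [MeasurableSpace Ω] {A : ℕ → Matrix (Fin n) (Fin n) ℝ}
  {ε : ℕ → Fin n → ℝ} {σ : ℝ} {γ X : ℕ → Ω → Fin n → ℝ}

theorem IsNoisyLearning.sub_const_succ (h : IsNoisyLearning A ε σ γ X) (t : ℕ) (ω : Ω) :
    (X (t + 1) ω - fun _ => σ) =
      (A (t + 1) - Matrix.diagonal (ε (t + 1))).mulVec (X t ω - fun _ => σ) +
        (Matrix.diagonal (ε (t + 1))).mulVec (γ (t + 1) ω) := by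
  have h1 : (A (t + 1)).mulVec (fun _ => σ) = fun _ => σ := by
    have := (h.stochastic (t + 1) (by omega)).2
    rw [show (fun _ : Fin n => σ) = σ • (1 : Fin n → ℝ) by ext; simp, Matrix.mulVec_smul, this]
  rw [h.recursion, Matrix.sub_mulVec, Matrix.mulVec_sub, Matrix.mulVec_sub, Matrix.mulVec_sub,
    Matrix.mulVec_add, h1]
  abel

theorem IsNoisyLearning.measurable (h : IsNoisyLearning A ε σ γ X) (t : ℕ) :
    Measurable (X t) := by
  induction t with
  | zero => exact h.measurable_initial
  | succ t ih =>
    have hγ := h.measurable_noise (t + 1) (by omega)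
    rw [funext (h.recursion t)]
    have hm : ∀ B : Matrix (Fin n) (Fin n) ℝ, Measurable B.mulVec := fun B =>
      (Continuous.matrix_mulVec continuous_const continuous_id).measurable
    exact ((hm _).comp ih).add ((hm _).comp ((hγ.const_add _).sub ih))

theorem contractionCoeff_nonneg {B : Matrix (Fin n) (Fin n) ℝ} {e : Fin n → ℝ}
    (hB : B ∈ Matrix.rowStochastic ℝ (Fin n)) : 0 ≤ contractionCoeff B e :=
  norm_sub_diagonal (ε := e) hB ▸ norm_nonneg _

theorem IsNoisyLearning.norm_sub_const_succ_le (h : IsNoisyLearning A ε σ γ X) (t : ℕ) (ω : Ω) :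
    ‖X (t + 1) ω - fun _ => σ‖ ≤ contractionCoeff (A (t + 1)) (ε (t + 1)) * ‖X t ω - fun _ => σ‖ +
      ‖Matrix.diagonal (ε (t + 1))‖ * ‖γ (t + 1) ω‖ := by
  rw [h.sub_const_succ, ← norm_sub_diagonal (h.stochastic (t + 1) (by omega))]
  exact (norm_add_le _ _).trans
    (add_le_add (Matrix.linfty_opNorm_mulVec _ _) (Matrix.linfty_opNorm_mulVec _ _))

theorem BoundedContraction.exists_contracting_weights (h : BoundedContraction A ε)
    (hA : ∀ t, 1 ≤ t → A t ∈ Matrix.rowStochastic ℝ (Fin n)) :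
    ∃ (w : ℕ → ℝ) (θ W : ℝ), 0 < θ ∧ θ < 1 ∧ (∀ t, 1 ≤ w t) ∧ (∀ t, w t ≤ W) ∧
      ∀ t, contractionCoeff (A (t + 1)) (ε (t + 1)) * w t ≤ θ * w (t + 1) :=
  _root_.exists_contracting_weights (ρ := fun t => contractionCoeff (A t) (ε t))
    (fun t ht => contractionCoeff_nonneg (hA t ht)) h

theorem BoundedContraction.exists_norm_diagonal_le (h : BoundedContraction A ε)
    (hA : ∀ t, 1 ≤ t → A t ∈ Matrix.rowStochastic ℝ (Fin n)) :
    ∃ C, 0 < C ∧ ∀ t, ‖Matrix.diagonal (ε (t + 1))‖ ≤ C := by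
  obtain ⟨w, θ, W, hθ, hθ1, hw, hW, hρ⟩ := h.exists_contracting_weights hA
  refine ⟨W + 1, by linarith [hw 0, hW 0], fun t => ?_⟩
  have h0 := contractionCoeff_nonneg (e := ε (t + 1)) (hA (t + 1) (by omega))
  have h1 := norm_diagonal_le (ε := ε (t + 1)) (hA (t + 1) (by omega))
  -- ρ_{t+1} ≤ ρ_{t+1} w_t ≤ θ w_{t+1} ≤ W.
  nlinarith [hρ t, hw t, hw (t + 1), hW (t + 1)]

theorem IsNoisyLearning.tendsto_of_tendsto (h : IsNoisyLearning A ε σ γ X)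
    (hb : BoundedContraction A ε) {ω : Ω} (hγ : Tendsto (fun t => γ t ω) atTop (𝓝 0)) :
    Tendsto (fun t => X t ω) atTop (𝓝 fun _ => σ) := by
  obtain ⟨w, θ, W, hθ, hθ1, hw, hW, hρ⟩ := hb.exists_contracting_weights h.stochastic
  obtain ⟨C, hC, hCε⟩ := hb.exists_norm_diagonal_le h.stochastic
  rw [tendsto_iff_norm_sub_tendsto_zero]
  refine tendsto_zero_of_weighted_recursion (ρ := fun t => contractionCoeff (A t) (ε t))
    (c := fun t => C * ‖γ (t + 1) ω‖) hθ hθ1 hw hW hρ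
    (fun t => norm_nonneg _) (fun t => by positivity) (fun t => ?_) ?_
  · exact (h.norm_sub_const_succ_le t ω).trans (by gcongr; exact hCε t)
  · simpa using ((tendsto_add_atTop_iff_nat 1).2 hγ).norm.const_mul C

theorem IsNoisyLearning.tendstoInMeasure {P : Measure Ω} [IsProbabilityMeasure P]
    (h : IsNoisyLearning A ε σ γ X) (hb : BoundedContraction A ε)
    (hγ : TendstoInMeasure P γ atTop (fun _ => 0))
    (hbdd : ∀ᵐ ω ∂P, BddAbove (range fun t : ℕ => ‖γ (t + 1) ω‖)) :
    TendstoInMeasure P X atTop (fun _ _ => σ) := by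
  obtain ⟨w, θ, W, hθ, hθ1, hw, hW, hρ⟩ := hb.exists_contracting_weights h.stochastic
  obtain ⟨C, hC, hCε⟩ := hb.exists_norm_diagonal_le h.stochastic
  rw [tendstoInMeasure_iff_norm] at hγ ⊢
  have hw0 : ∀ t, 0 < w t := fun t => zero_lt_one.trans_le (hw t)
  have hW0 : 0 < W := (hw0 0).trans_le (hW 0)
  have hrec : ∀ t ω, ‖X (t + 1) ω - fun _ => σ‖ / w (t + 1) ≤
      θ * (‖X t ω - fun _ => σ‖ / w t) + C * ‖γ (t + 1) ω‖ := fun t ω =>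
    div_weight_recursion (ρ := fun t => contractionCoeff (A t) (ε t))
      (y := fun t => ‖X t ω - fun _ => σ‖) (c := fun t => C * ‖γ (t + 1) ω‖) hw hρ
      (fun t => norm_nonneg _) (fun t => by positivity)
      (fun t => (h.norm_sub_const_succ_le t ω).trans (by gcongr; exact hCε t)) t
  have hmeas : ∀ t, Measurable fun ω => ‖X t ω - fun _ => σ‖ / w t := fun t =>
    ((h.measurable t).sub_const _).norm.div_const _
  have hnoise : ∀ δ > 0, Tendsto (fun t => P {ω | δ ≤ C * ‖γ (t + 1) ω‖}) atTop (𝓝 0) := by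
    intro δ hδ
    have := (tendsto_add_atTop_iff_nat 1).2 (hγ (δ / C) (by positivity))
    simpa [div_le_iff₀' hC] using this
  have hbdd' : ∀ᵐ ω ∂P, ∃ b, ∀ t, ‖X t ω - fun _ => σ‖ / w t ≤ b := by
    filter_upwards [hbdd] with ω hω
    obtain ⟨b, hb⟩ := hω
    have hb0 : 0 ≤ b := (norm_nonneg _).trans (hb ⟨0, rfl⟩)
    have h1θ : 0 < 1 - θ := sub_pos.2 hθ1
    refine ⟨‖X 0 ω - fun _ => σ‖ / w 0 + C * b / (1 - θ), fun t => ?_⟩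
    refine (le_geometric_of_recursion (b := C * b / (1 - θ))
      (y := fun t => ‖X t ω - fun _ => σ‖ / w t) hθ.le (by positivity) (fun t => ?_) t).trans ?_
    · refine (hrec t ω).trans ?_
      rw [mul_div_cancel₀ _ h1θ.ne']
      gcongr
      exact hb ⟨t, rfl⟩
    · gcongr
      exact mul_le_of_le_one_left (div_nonneg (norm_nonneg _) (hw0 0).le)
        (pow_le_one₀ hθ.le hθ1.le)
  intro δ hδ
  refine tendsto_of_tendsto_of_tendsto_of_le_of_le tendsto_const_nhds
    (tendsto_measure_of_recursion hθ hθ1 hmeas hrec hnoise hbdd' (div_pos hδ hW0))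
    (fun _ => bot_le) fun t => measure_mono fun ω hω => ?_
  exact div_le_div₀ (norm_nonneg _) hω (hw0 t) (hW t)

theorem IsNoisyLearning.tendsto_eLpNorm {P : Measure Ω} [IsProbabilityMeasure P]
    (h : IsNoisyLearning A ε σ γ X) (hb : BoundedContraction A ε) {p : ENNReal} (hp : 1 ≤ p)
    (hX : MemLp (X 0) p P) (hγ : ∀ t, 1 ≤ t → MemLp (γ t) p P)
    (hlim : Tendsto (fun t => eLpNorm (γ t) p P) atTop (𝓝 0)) :
    (∀ t, MemLp (X t) p P) ∧
      Tendsto (fun t => eLpNorm (fun ω => X t ω - fun _ => σ) p P) atTop (𝓝 0) := by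
  obtain ⟨w, θ, W, hθ, hθ1, hw, hW, hρ⟩ := hb.exists_contracting_weights h.stochastic
  obtain ⟨C, hC, hCε⟩ := hb.exists_norm_diagonal_le h.stochastic
  have hstep : ∀ t, MemLp (fun ω => X t ω - fun _ => σ) p P → _ := fun t ht =>
    MemLp.of_norm_le_add hp (contractionCoeff_nonneg (h.stochastic (t + 1) (by omega))) hC.le
      ((h.measurable (t + 1)).sub_const _).aestronglyMeasurable ht (hγ (t + 1) (by omega))
      fun ω => (h.norm_sub_const_succ_le t ω).trans (by gcongr; exact hCε t)
  have hmem : ∀ t, MemLp (fun ω => X t ω - fun _ => σ) p P := by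
    intro t
    induction t with
    | zero => exact hX.sub (memLp_const _)
    | succ t ih => exact (hstep t ih).1
  refine ⟨fun t => ?_, ?_⟩
  · simpa [Pi.add_def] using (hmem t).add (memLp_const fun _ => σ)
  rw [← ENNReal.tendsto_toReal_iff (fun t => (hmem t).eLpNorm_ne_top) ENNReal.zero_ne_top,
    ENNReal.toReal_zero]
  refine tendsto_zero_of_weighted_recursion (ρ := fun t => contractionCoeff (A t) (ε t))
    (c := fun t => C * (eLpNorm (γ (t + 1)) p P).toReal) hθ hθ1 hw hW hρ
    (fun t => ENNReal.toReal_nonneg) (fun t => by positivity) (fun t => (hstep t (hmem t)).2) ?_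
  simpa using ((ENNReal.tendsto_toReal ENNReal.zero_ne_top).comp
    ((tendsto_add_atTop_iff_nat 1).2 hlim)).const_mul C

end Deviation

/-! ### Failure of convergence for oscillating learning rates -/

section Oscillation

variable {n : ℕ} {Ω : Type*} [MeasurableSpace Ω] {P : Measure Ω} [IsProbabilityMeasure P]

/-- If `η, η'` are independent copies of an integrable centred variable and `2 η' - η` has the law
of `η`, then `η` vanishes almost surely. -/
theorem ae_eq_zero_of_identDistrib_two_mul_sub {η η' : Ω → ℝ} (hη : Measurable η)
    (hη' : Measurable η') (hind : IndepFun η η' P) (hid : IdentDistrib η' η P P)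
    (hint : Integrable η P) (hmean : ∫ ω, η ω ∂P = 0)
    (hlaw : IdentDistrib (fun ω => 2 * η' ω - η ω) η P P) : η =ᵐ[P] 0 := by
  set μ := P.map η with hμ
  have hμ' : P.map η' = μ := hid.map_eq
  have hintμ : Integrable (fun x : ℝ => x) μ :=
    (integrable_map_measure aestronglyMeasurable_id hη.aemeasurable).2 hint
  have hprob : IsProbabilityMeasure μ := Measure.isProbabilityMeasure_map hη.aemeasurable
  have hmeanμ : ∫ x, x ∂μ = 0 := by
    rw [hμ, integral_map hη.aemeasurable (f := fun x => x) (by fun_prop)]; exact hmean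
  have h1 : ∫ ω, ‖2 * η' ω - η ω‖ ∂P = ∫ x, ‖x‖ ∂μ := by
    rw [hμ, integral_map hη.aemeasurable (by fun_prop)]
    exact (hlaw.comp measurable_norm).integral_eq
  have h2 : ∫ ω, ‖2 * η' ω - η ω‖ ∂P = ∫ z : ℝ × ℝ, ‖2 * z.2 - z.1‖ ∂(μ.prod μ) := by
    have := (indepFun_iff_map_prod_eq_prod_map_map hη.aemeasurable hη'.aemeasurable).1 hind
    rw [hμ'] at this
    rw [← this, integral_map (by fun_prop) (by fun_prop)]
  have hi : Integrable (fun z : ℝ × ℝ => ‖2 * z.2 - z.1‖) (μ.prod μ) :=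
    ((hintμ.comp_snd μ).const_mul 2 |>.sub (hintμ.comp_fst μ)).norm
  have h3 : ∫ z : ℝ × ℝ, ‖2 * z.2 - z.1‖ ∂(μ.prod μ) = ∫ y, ∫ x, ‖2 * y - x‖ ∂μ ∂μ :=
    integral_prod_symm _ hi
  -- Averaging out the centred x inside the norm leaves 2y. With `hlaw` this gives 2 E|η| ≤ E|η|.
  have h4 : ∫ y, 2 * ‖y‖ ∂μ ≤ ∫ y, ∫ x, ‖2 * y - x‖ ∂μ ∂μ := by
    refine integral_mono (hintμ.norm.const_mul 2) hi.integral_prod_right fun y => ?_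
    calc 2 * ‖y‖ = ‖∫ x, (2 * y - x) ∂μ‖ := by
          rw [integral_sub (integrable_const _) hintμ, hmeanμ]; simp
      _ ≤ _ := norm_integral_le_integral_norm _
  have h5 : ∫ ω, ‖η ω‖ ∂P = 0 := by
    have h6 : ∫ x, ‖x‖ ∂μ = ∫ ω, ‖η ω‖ ∂P := by
      rw [hμ, integral_map hη.aemeasurable (by fun_prop)]
    rw [integral_const_mul] at h4
    have h7 : 0 ≤ ∫ ω, ‖η ω‖ ∂P := integral_nonneg fun _ => norm_nonneg _
    linarith
  filter_upwards [(integral_eq_zero_iff_of_nonneg (fun _ => norm_nonneg _) hint.norm).1 h5]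
    with ω hω
  simpa using hω

theorem ae_eq_const_of_identDistrib_two_smul_sub {ξ ξ' : Ω → Fin n → ℝ} (hξ : Measurable ξ)
    (hξ' : Measurable ξ') (hind : IndepFun ξ ξ' P) (hid : IdentDistrib ξ' ξ P P)
    (hint : Integrable ξ P)
    (hlaw : IdentDistrib (fun ω => (2 : ℝ) • ξ' ω - ξ ω) ξ P P) :
    ∃ c : Fin n → ℝ, ∀ᵐ ω ∂P, ξ ω = c := by
  refine ⟨fun i => ∫ ω, ξ ω i ∂P, ?_⟩
  suffices h : ∀ i, ∀ᵐ ω ∂P, ξ ω i = ∫ ω, ξ ω i ∂P by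
    filter_upwards [ae_all_iff.2 h] with ω hω using funext hω
  intro i
  set m := ∫ ω, ξ ω i ∂P
  have hinti : Integrable (fun ω => ξ ω i) P := hint.eval i
  have hm : Measurable fun v : Fin n → ℝ => v i - m := by fun_prop
  have := ae_eq_zero_of_identDistrib_two_mul_sub (η := fun ω => ξ ω i - m)
    (η' := fun ω => ξ' ω i - m) (by fun_prop) (by fun_prop) (hind.comp hm hm) (hid.comp hm)
    (hinti.sub (integrable_const m))
    (by rw [integral_sub hinti (integrable_const m)]; simp [m])
    (by
      convert hlaw.comp hm using 1
      · ext ω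
        simp only [Function.comp, Pi.sub_apply, Pi.smul_apply, smul_eq_mul]
        ring
      · rfl)
  filter_upwards [this] with ω hω
  exact sub_eq_zero.1 hω

/-- Learning rate `1` at even times and `2` at odd times. -/
def oscillatingRate (n t : ℕ) : Fin n → ℝ := fun _ => if Even t then 1 else 2

theorem contractionCoeff_oscillatingRate (hn : 1 ≤ n) (t : ℕ) :
    contractionCoeff 1 (oscillatingRate n t) = if Even t then 0 else 1 := by
  have : Nonempty (Fin n) := ⟨⟨0, hn⟩⟩
  simp only [contractionCoeff, oscillatingRate, Matrix.one_apply_eq]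
  split_ifs <;> norm_num

theorem boundedContraction_oscillatingRate (hn : 1 ≤ n) :
    BoundedContraction (fun _ => 1) (oscillatingRate n) := by
  set ρ : ℕ → ℝ := fun t => if Even t then 0 else 1 with hρ
  -- Any product over two consecutive times contains a zero factor, so only s = t survives.
  have key : ∀ t, ∑ s ∈ Finset.Icc 1 t, ∏ j ∈ Finset.Icc s t, ρ j = ρ t := by
    intro t
    induction t with
    | zero => simp [hρ]
    | succ t ih =>
      rw [Finset.sum_Icc_succ_top (by omega), Finset.Icc_self, Finset.prod_singleton]
      have h1 : ∀ s ∈ Finset.Icc 1 t, ∏ j ∈ Finset.Icc s (t + 1), ρ j =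
          (∏ j ∈ Finset.Icc s t, ρ j) * ρ (t + 1) := fun s hs =>
        Finset.prod_Icc_succ_top (by have := (Finset.mem_Icc.1 hs).2; omega) _
      rw [Finset.sum_congr rfl h1, ← Finset.sum_mul, ih]
      rcases Nat.even_or_odd t with h | h
      · simp [hρ, h]
      · simp [hρ, h.add_one]
  refine ⟨1, ?_⟩
  rintro S ⟨t, -, rfl⟩
  simp_rw [contractionCoeff_oscillatingRate hn]
  rw [key t]
  simp only [hρ]
  split_ifs <;> norm_num

theorem not_summableVariation_oscillatingRate (hn : 1 ≤ n) :
    ¬ SummableVariation (fun _ => 1) (oscillatingRate n) := by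
  intro h
  refine absurd (ge_of_tendsto' h.tendsto_atTop_zero fun t => ?_) (by norm_num : ¬ (1 : ℝ) ≤ 0)
  -- Testing on the all-ones vector shows that every increment of the rates has norm at least 1.
  have h1 := Matrix.linfty_opNorm_mulVec
    (Matrix.diagonal (oscillatingRate n (t + 1)) - Matrix.diagonal (oscillatingRate n t)) 1
  have h2 : ‖(1 : Fin n → ℝ)‖ ≤ 1 := (pi_norm_le_iff_of_nonneg zero_le_one).2 fun i => by simp
  have h3 := norm_le_pi_norm ((Matrix.diagonal (oscillatingRate n (t + 1)) -
    Matrix.diagonal (oscillatingRate n t)).mulVec 1) ⟨0, hn⟩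
  have h4 : ‖(Matrix.diagonal (oscillatingRate n (t + 1)) -
      Matrix.diagonal (oscillatingRate n t)).mulVec 1 ⟨0, hn⟩‖ = 1 := by
    rw [Matrix.sub_mulVec, Pi.sub_apply, Matrix.mulVec_diagonal, Matrix.mulVec_diagonal]
    simp only [oscillatingRate, Nat.even_add_one, Pi.one_apply, mul_one]
    split_ifs <;> norm_num
  rw [sub_self, norm_zero, zero_add]
  nlinarith [norm_nonneg (Matrix.diagonal (oscillatingRate n (t + 1)) -
    Matrix.diagonal (oscillatingRate n t))]

theorem TendstoInDistribution.comp_tendsto {E Ω' ι κ : Type*} [MeasurableSpace Ω']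
    [TopologicalSpace E] [MeasurableSpace E] [OpensMeasurableSpace E] {μ : Measure Ω'}
    [IsProbabilityMeasure μ] {X : ι → Ω → E} {Z : Ω' → E} {l : Filter ι} {l' : Filter κ}
    (h : TendstoInDistribution X l Z (fun _ => P) μ) {u : κ → ι} (hu : Tendsto u l' l) :
    TendstoInDistribution (fun k => X (u k)) l' Z (fun _ => P) μ :=
  ⟨fun k => h.forall_aemeasurable (u k), h.aemeasurable_limit, h.tendsto.comp hu⟩

theorem not_convergesInDistribution_oscillatingRate {σ : ℝ} {γ X : ℕ → Ω → Fin n → ℝ}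
    (h : IsNoisyLearning (fun _ => 1) (oscillatingRate n) σ γ X) (hγ : IsIIDIntegrable P γ)
    (hconst : ¬ ∃ c : Fin n → ℝ, ∀ᵐ ω ∂P, γ 1 ω = c) : ¬ ConvergesInDistribution P X := by
  rintro ⟨ν, hν⟩
  refine hconst ?_
  have hid : ∀ s t, 1 ≤ s → 1 ≤ t → IdentDistrib (γ s) (γ t) P P := fun s t hs ht =>
    (hγ.ident s hs).trans (hγ.ident t ht).symm
  have hind : ∀ s t, s ≠ t → IndepFun (γ (s + 1)) (γ (t + 1)) P := fun s t hst =>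
    hγ.indep.indepFun hst
  -- Rate 1 with A = 1 erases the past, whatever the initial vector.
  have heven : ∀ k, X (2 * k + 2) = fun ω => (fun _ => σ) + γ (2 * k + 2) ω := by
    intro k
    funext ω
    have : Even (2 * k + 1 + 1) := ⟨k + 1, by ring⟩
    ext i
    rw [h.recursion]
    simp [Matrix.mulVec_diagonal, oscillatingRate, this]
  have hodd : ∀ k, X (2 * k + 3) = fun ω => (fun _ => σ) +
      ((2 : ℝ) • γ (2 * k + 3) ω - γ (2 * k + 2) ω) := by
    intro k
    funext ω
    have : ¬ Even (2 * k + 2 + 1) := by rw [Nat.not_even_iff_odd]; exact ⟨k + 1, by ring⟩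
    ext i
    rw [h.recursion, heven]
    simp [Matrix.mulVec_diagonal, oscillatingRate, this]
    ring
  have hpair : ∀ k, IdentDistrib (fun ω => (γ (2 * k + 2) ω, γ (2 * k + 3) ω))
      (fun ω => (γ 1 ω, γ 2 ω)) P P := fun k =>
    (hid _ _ (by omega) le_rfl).prodMk (hid _ _ (by omega) (by omega))
      (hind (2 * k + 1) (2 * k + 2) (by omega)) (hind 0 1 (by omega))
  have hadd : Measurable fun v : Fin n → ℝ => (fun _ => σ) + v := by fun_prop
  have hsub : Measurable fun v : (Fin n → ℝ) × (Fin n → ℝ) =>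
      (fun _ => σ) + ((2 : ℝ) • v.2 - v.1) := by fun_prop
  have htwo : ∀ j, Tendsto (fun k => 2 * k + j) atTop atTop := fun j =>
    tendsto_atTop_mono (fun k => show k ≤ 2 * k + j by omega) tendsto_id
  have hE := TendstoInDistribution.comp_tendsto hν (htwo 2)
  have hO := TendstoInDistribution.comp_tendsto hν (htwo 3)
  have hE' : TendstoInDistribution (fun k => X (2 * k + 2)) atTop
      (fun ω => (fun _ => σ) + γ 1 ω) (fun _ => P) P := by
    have he : ∀ k, IdentDistrib (X (2 * k + 2)) (fun ω => (fun _ => σ) + γ 1 ω) P P := fun k => by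
      rw [heven]; exact (hid _ 1 (by omega) le_rfl).comp hadd
    exact tendstoInDistribution_of_identDistrib 0 (fun j => (he 0).trans (he j).symm) (he 0)
  have hO' : TendstoInDistribution (fun k => X (2 * k + 3)) atTop
      (fun ω => (fun _ => σ) + ((2 : ℝ) • γ 2 ω - γ 1 ω)) (fun _ => P) P := by
    have ho : ∀ k, IdentDistrib (X (2 * k + 3))
        (fun ω => (fun _ => σ) + ((2 : ℝ) • γ 2 ω - γ 1 ω)) P P := fun k => by
      rw [hodd]; exact (hpair k).comp hsub
    exact tendstoInDistribution_of_identDistrib 0 (fun j => (ho 0).trans (ho j).symm) (ho 0)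
  have hlaw : P.map (fun ω => (fun _ => σ) + ((2 : ℝ) • γ 2 ω - γ 1 ω)) =
      P.map fun ω => (fun _ => σ) + γ 1 ω :=
    (tendstoInDistribution_unique _ hO' hO).trans (tendstoInDistribution_unique _ hE hE')
  have h1 := h.measurable_noise 1 le_rfl
  have h2 := h.measurable_noise 2 (by omega)
  have hident : IdentDistrib (fun ω => (fun _ => σ) + ((2 : ℝ) • γ 2 ω - γ 1 ω))
      (fun ω => (fun _ => σ) + γ 1 ω) P P := ⟨by fun_prop, by fun_prop, hlaw⟩
  refine ae_eq_const_of_identDistrib_two_smul_sub h1 h2 (hind 0 1 (by omega))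
    (hid 2 1 (by omega) le_rfl) hγ.integrable ?_
  have hback : Measurable fun v : Fin n → ℝ => v - fun _ => σ := by fun_prop
  simpa [Function.comp_def] using hident.comp hback

end Oscillation

/-! ### Convergence in distribution -/

section Distribution

variable {n : ℕ} {Ω : Type*}

/-- The solution of `Z_{t+1} = B Z_t + E γ_{t+1}`, `Z_0 = 0`. -/
noncomputable def autoregression (B E : Matrix (Fin n) (Fin n) ℝ) (γ : ℕ → Ω → Fin n → ℝ) (t : ℕ)
    (ω : Ω) : Fin n → ℝ :=
  ∑ k ∈ Finset.range t, (B ^ k).mulVec (E.mulVec (γ (t - k) ω))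

theorem autoregression_succ (B E : Matrix (Fin n) (Fin n) ℝ) (γ : ℕ → Ω → Fin n → ℝ) (t : ℕ)
    (ω : Ω) : autoregression B E γ (t + 1) ω =
      B.mulVec (autoregression B E γ t ω) + E.mulVec (γ (t + 1) ω) := by
  rw [autoregression, Finset.sum_range_succ', autoregression, Matrix.mulVec_sum]
  simp [pow_succ', Matrix.mulVec_mulVec, Matrix.mul_assoc]

variable [MeasurableSpace Ω] {P : Measure Ω}
  {A : ℕ → Matrix (Fin n) (Fin n) ℝ} {ε : ℕ → Fin n → ℝ} {σ : ℝ} {γ X : ℕ → Ω → Fin n → ℝ}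

theorem measurable_mulVec (B : Matrix (Fin n) (Fin n) ℝ) : Measurable B.mulVec :=
  (Continuous.matrix_mulVec continuous_const continuous_id).measurable

theorem norm_pow_mulVec_le (B : Matrix (Fin n) (Fin n) ℝ) (k : ℕ) (v : Fin n → ℝ) :
    ‖(B ^ k).mulVec v‖ ≤ ‖B‖ ^ k * ‖v‖ := by
  induction k with
  | zero => simp
  | succ k ih =>
    rw [pow_succ', ← Matrix.mulVec_mulVec, pow_succ', mul_assoc]
    exact (Matrix.linfty_opNorm_mulVec _ _).trans (by gcongr)

theorem SummableVariation.exists_tendsto (h : SummableVariation A ε) :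
    ∃ A' E : Matrix (Fin n) (Fin n) ℝ, Tendsto A atTop (𝓝 A') ∧
      Tendsto (fun t => Matrix.diagonal (ε t)) atTop (𝓝 E) := by
  let : NormedSpace ℝ (Matrix (Fin n) (Fin n) ℝ) := Matrix.linftyOpNormedSpace
  have : CompleteSpace (Matrix (Fin n) (Fin n) ℝ) := FiniteDimensional.complete ℝ _
  have h1 : Summable fun t => ‖A (t + 1) - A t‖ :=
    h.of_nonneg_of_le (fun t => norm_nonneg _) fun t => le_add_of_nonneg_right (norm_nonneg _)
  have h2 : Summable fun t => ‖Matrix.diagonal (ε (t + 1)) - Matrix.diagonal (ε t)‖ :=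
    h.of_nonneg_of_le (fun t => norm_nonneg _) fun t => le_add_of_nonneg_left (norm_nonneg _)
  obtain ⟨A', hA'⟩ := cauchySeq_tendsto_of_complete
    (cauchySeq_of_summable_dist (f := A) (by simpa [dist_eq_norm, norm_sub_rev] using h1))
  obtain ⟨E, hE⟩ := cauchySeq_tendsto_of_complete
    (cauchySeq_of_summable_dist (f := fun t => Matrix.diagonal (ε t))
      (by simpa only [dist_eq_norm, norm_sub_rev] using h2))
  exact ⟨A', E, hA', hE⟩

/-- Time reversal preserves the joint law of finitely many iid vectors. It replaces the
autoregression, whose newest noise enters with B^0, by partial sums of one fixed series. -/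
theorem IsIIDIntegrable.identDistrib_reverse (hγ : IsIIDIntegrable P γ) (t : ℕ) :
    IdentDistrib (fun ω (k : Fin t) => γ (t - k) ω) (fun ω (k : Fin t) => γ (k + 1) ω) P P := by
  refine IdentDistrib.pi (X := fun (k : Fin t) => γ (t - k)) (Y := fun (k : Fin t) => γ (k + 1))
    (fun k => (hγ.ident _ (by omega)).trans (hγ.ident _ (by omega)).symm) ?_ ?_
  · have := hγ.indep.precomp (g := fun k : Fin t => t - 1 - (k : ℕ))
      (fun i j hij => Fin.ext (by have := i.2; have := j.2; simp only at hij; omega))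
    have he : ∀ k : Fin t, t - 1 - (k : ℕ) + 1 = t - k := fun k => by omega
    simpa only [he] using this
  · exact hγ.indep.precomp (g := fun k : Fin t => (k : ℕ)) Fin.val_injective

theorem IsIIDIntegrable.identDistrib_autoregression (hγ : IsIIDIntegrable P γ)
    (B E : Matrix (Fin n) (Fin n) ℝ) (t : ℕ) :
    IdentDistrib (autoregression B E γ t)
      (fun ω => ∑ k ∈ Finset.range t, (B ^ k).mulVec (E.mulVec (γ (k + 1) ω))) P P := by
  have hm : Measurable fun v : Fin t → Fin n → ℝ => ∑ k : Fin t,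
      (B ^ (k : ℕ)).mulVec (E.mulVec (v k)) := Finset.measurable_sum _ fun k _ =>
    (measurable_mulVec _).comp ((measurable_mulVec _).comp (measurable_pi_apply k))
  have := (hγ.identDistrib_reverse t).comp hm
  convert this using 1
  · funext ω
    simp [autoregression, Finset.sum_range]
  · funext ω
    simp [Finset.sum_range]

/-- By Tonelli the expected sum is E‖γ_1‖ · ∑ a_k, which is finite. -/
theorem IsIIDIntegrable.ae_summable (hγ : IsIIDIntegrable P γ) {a : ℕ → ℝ} (ha : ∀ k, 0 ≤ a k)
    (hs : Summable a) : ∀ᵐ ω ∂P, Summable fun k => a k * ‖γ (k + 1) ω‖ := by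
  have hmeas : ∀ k, AEMeasurable (fun ω => ENNReal.ofReal (a k) * ‖γ (k + 1) ω‖ₑ) P := fun k =>
    ((hγ.ident (k + 1) (by omega)).aemeasurable_fst.enorm).const_mul _
  have hlint : ∀ k, ∫⁻ ω, ‖γ (k + 1) ω‖ₑ ∂P = ∫⁻ ω, ‖γ 1 ω‖ₑ ∂P := fun k =>
    ((hγ.ident (k + 1) (by omega)).comp measurable_enorm).lintegral_eq
  have hfin : ∫⁻ ω, ∑' k, ENNReal.ofReal (a k) * ‖γ (k + 1) ω‖ₑ ∂P ≠ ⊤ := by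
    rw [lintegral_tsum hmeas]
    simp_rw [lintegral_const_mul' _ _ ENNReal.ofReal_ne_top, hlint, ENNReal.tsum_mul_right]
    refine ENNReal.mul_ne_top ?_ hγ.integrable.2.ne
    rw [← ENNReal.ofReal_tsum_of_nonneg ha hs]
    exact ENNReal.ofReal_ne_top
  filter_upwards [ae_lt_top' (AEMeasurable.tsum hmeas) hfin] with ω hω
  simpa [ENNReal.toReal_mul, ENNReal.toReal_ofReal, ha] using ENNReal.summable_toReal hω.ne

variable [IsProbabilityMeasure P]

theorem IsIIDIntegrable.exists_tendstoInDistribution_autoregression (hγ : IsIIDIntegrable P γ)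
    {B : Matrix (Fin n) (Fin n) ℝ} (E : Matrix (Fin n) (Fin n) ℝ) (hB : ‖B‖ < 1) :
    ∃ Z : Ω → Fin n → ℝ,
      TendstoInDistribution (autoregression B E γ) atTop Z (fun _ => P) P := by
  have hid := hγ.identDistrib_autoregression B E
  set S : ℕ → Ω → Fin n → ℝ := fun t ω =>
    ∑ k ∈ Finset.range t, (B ^ k).mulVec (E.mulVec (γ (k + 1) ω)) with hS
  have hlim : ∀ᵐ ω ∂P, Tendsto (fun t => S t ω) atTop
      (𝓝 (∑' k, (B ^ k).mulVec (E.mulVec (γ (k + 1) ω)))) := by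
    filter_upwards [hγ.ae_summable (a := fun k => ‖B‖ ^ k * ‖E‖) (fun k => by positivity)
      ((summable_geometric_of_lt_one (norm_nonneg _) hB).mul_right _)] with ω hω
    refine (Summable.of_norm_bounded hω fun k => ?_).hasSum.tendsto_sum_nat
    refine (norm_pow_mulVec_le _ _ _).trans ?_
    rw [mul_assoc]
    gcongr
    exact Matrix.linfty_opNorm_mulVec _ _
  have hSm : ∀ t, AEMeasurable (S t) P := fun t => (hid t).aemeasurable_snd
  have hconv := tendstoInDistribution_of_ae_tendsto hSm
    (aemeasurable_of_tendsto_metrizable_ae atTop hSm hlim) hlim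
  refine ⟨_, fun t => (hid t).aemeasurable_fst, hconv.aemeasurable_limit, ?_⟩
  -- Only the laws for each single t agree, which is all that weak convergence sees.
  exact hconv.tendsto.congr fun t => Subtype.ext (hid t).map_eq.symm

theorem IsNoisyLearning.convergesInDistribution_of_initial_eq
    (h : IsNoisyLearning A ε σ γ X) (hb : BoundedContraction A ε) (hγ : IsIIDIntegrable P γ)
    (hv : SummableVariation A ε) (h0 : ∀ ω, X 0 ω = fun _ => σ) :
    ∃ Z : Ω → Fin n → ℝ, TendstoInDistribution X atTop Z (fun _ => P) P := by
  obtain ⟨w, θ, W, hθ, hθ1, hw, hW, hρ⟩ := hb.exists_contracting_weights h.stochastic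
  obtain ⟨A', E, hA', hE⟩ := hv.exists_tendsto
  obtain ⟨B, hBlim⟩ : ∃ B, Tendsto (fun t => A t - Matrix.diagonal (ε t)) atTop (𝓝 B) :=
    ⟨_, hA'.sub hE⟩
  have hB : ‖B‖ < 1 := by
    refine lt_one_of_tendsto_of_weights (ρ := fun t => contractionCoeff (A t) (ε t)) hθ hθ1 hw hW
      hρ (hBlim.norm.congr' ?_)
    filter_upwards [eventually_ge_atTop 1] with t ht
    exact norm_sub_diagonal (h.stochastic t ht)
  obtain ⟨Z, hZ⟩ := hγ.exists_tendstoInDistribution_autoregression E hB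
  set Y := autoregression B E γ with hY
  have hYm : ∀ t, Measurable (Y t) := fun t => Finset.measurable_sum _ fun k hk =>
    (measurable_mulVec _).comp ((measurable_mulVec _).comp
      (h.measurable_noise _ (by have := Finset.mem_range.1 hk; omega)))
  have hγmem : ∀ t, MemLp (γ (t + 1)) 1 P := fun t =>
    (hγ.ident (t + 1) (by omega)).symm.memLp_snd (memLp_one_iff_integrable.2 hγ.integrable)
  have hγnorm : ∀ t, (eLpNorm (γ (t + 1)) 1 P).toReal = (eLpNorm (γ 1) 1 P).toReal := fun t => by
    rw [(hγ.ident (t + 1) (by omega)).eLpNorm_eq]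
  set m := (eLpNorm (γ 1) 1 P).toReal with hm
  have hYstep : ∀ t, MemLp (Y t) 1 P → _ := fun t ht =>
    MemLp.of_norm_le_add le_rfl (norm_nonneg B) (norm_nonneg E) (hYm (t + 1)).aestronglyMeasurable
      ht (hγmem t) fun ω => by
        rw [hY, autoregression_succ]
        exact (norm_add_le _ _).trans
          (add_le_add (Matrix.linfty_opNorm_mulVec _ _) (Matrix.linfty_opNorm_mulVec _ _))
  have hY0 : Y 0 = 0 := by ext; simp [hY, autoregression]
  have hYmem : ∀ t, MemLp (Y t) 1 P := by
    intro t
    induction t with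
    | zero => rw [hY0]; exact MemLp.zero
    | succ t ih => exact (hYstep t ih).1
  have h1B : 0 < 1 - ‖B‖ := sub_pos.2 hB
  -- The fixed point of x ↦ ‖B‖x + ‖E‖m, which bounds E‖Y_t‖ uniformly in t.
  set K := ‖E‖ * m / (1 - ‖B‖) with hK
  have hYnorm : ∀ t, (eLpNorm (Y t) 1 P).toReal ≤ K := by
    intro t
    have := le_geometric_of_recursion (y := fun t => (eLpNorm (Y t) 1 P).toReal) (b := K)
      (norm_nonneg B) (by positivity) (fun t => by
        rw [hK, mul_div_cancel₀ _ h1B.ne', ← hγnorm t]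
        exact (hYstep t (hYmem t)).2) t
    simpa [hY0] using this
  set D : ℕ → Ω → Fin n → ℝ := fun t ω => (X t ω - fun _ => σ) - Y t ω with hD
  have hDm : ∀ t, Measurable (D t) := fun t => ((h.measurable t).sub_const _).sub (hYm t)
  set β : ℕ → ℝ := fun t => ‖A (t + 1) - Matrix.diagonal (ε (t + 1)) - B‖ with hβ
  set η : ℕ → ℝ := fun t => ‖Matrix.diagonal (ε (t + 1)) - E‖ with hη
  -- The forcing of D consists of coefficient errors times L^1-bounded vectors, so it vanishes in
  -- L^1 although the noise does not.
  have hDrec : ∀ t ω, ‖D (t + 1) ω‖ ≤ contractionCoeff (A (t + 1)) (ε (t + 1)) * ‖D t ω‖ +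
      1 * ‖β t * ‖Y t ω‖ + η t * ‖γ (t + 1) ω‖‖ := by
    intro t ω
    have he : D (t + 1) ω = (A (t + 1) - Matrix.diagonal (ε (t + 1))).mulVec (D t ω) +
        ((A (t + 1) - Matrix.diagonal (ε (t + 1)) - B).mulVec (Y t ω) +
          (Matrix.diagonal (ε (t + 1)) - E).mulVec (γ (t + 1) ω)) := by
      simp only [hD]
      rw [h.sub_const_succ, hY, autoregression_succ, Matrix.mulVec_sub _ (X t ω - _),
        Matrix.sub_mulVec _ B, Matrix.sub_mulVec _ E]
      abel
    rw [he, one_mul, Real.norm_of_nonneg (by positivity),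
      ← norm_sub_diagonal (h.stochastic (t + 1) (by omega))]
    exact (norm_add_le _ _).trans (add_le_add (Matrix.linfty_opNorm_mulVec _ _)
      ((norm_add_le _ _).trans
        (add_le_add (Matrix.linfty_opNorm_mulVec _ _) (Matrix.linfty_opNorm_mulVec _ _))))
  have hnoise : ∀ t, MemLp (fun ω => β t * ‖Y t ω‖ + η t * ‖γ (t + 1) ω‖) 1 P ∧
      (eLpNorm (fun ω => β t * ‖Y t ω‖ + η t * ‖γ (t + 1) ω‖) 1 P).toReal ≤ β t * K + η t * m := by
    intro t
    have := MemLp.of_norm_le_add le_rfl (norm_nonneg _ : 0 ≤ β t) (norm_nonneg _ : 0 ≤ η t)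
      (f := fun ω => β t * ‖Y t ω‖ + η t * ‖γ (t + 1) ω‖)
      (((hYmem t).norm.const_mul _).add ((hγmem t).norm.const_mul _)).1 (hYmem t) (hγmem t)
      (fun ω => (Real.norm_of_nonneg (by positivity)).le)
    refine ⟨this.1, this.2.trans ?_⟩
    rw [hγnorm]
    gcongr
    exact hYnorm t
  have hDstep : ∀ t, MemLp (D t) 1 P → _ := fun t ht =>
    MemLp.of_norm_le_add le_rfl (contractionCoeff_nonneg (h.stochastic (t + 1) (by omega)))
      zero_le_one (hDm (t + 1)).aestronglyMeasurable ht (hnoise t).1 (hDrec t)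
  have hDmem : ∀ t, MemLp (D t) 1 P := by
    intro t
    induction t with
    | zero =>
      have : D 0 = 0 := by ext ω i; simp [hD, h0, hY0]
      rw [this]; exact MemLp.zero
    | succ t ih => exact (hDstep t ih).1
  have hK0 : 0 ≤ K := by positivity
  have hβη : Tendsto (fun t => β t * K + η t * m) atTop (𝓝 0) := by
    have h1 := tendsto_iff_norm_sub_tendsto_zero.1 ((tendsto_add_atTop_iff_nat 1).2 hBlim)
    have h2 := tendsto_iff_norm_sub_tendsto_zero.1 ((tendsto_add_atTop_iff_nat 1).2 hE)
    simpa using (h1.mul_const K).add (h2.mul_const m)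
  have hDlim : Tendsto (fun t => (eLpNorm (D t) 1 P).toReal) atTop (𝓝 0) := by
    refine tendsto_zero_of_weighted_recursion (ρ := fun t => contractionCoeff (A t) (ε t))
      hθ hθ1 hw hW hρ (fun t => ENNReal.toReal_nonneg) (fun t => by positivity) (fun t => ?_) hβη
    refine (hDstep t (hDmem t)).2.trans ?_
    rw [one_mul]
    gcongr
    exact (hnoise t).2
  have hDmeas : TendstoInMeasure P D atTop 0 := by
    refine tendstoInMeasure_of_tendsto_eLpNorm one_ne_zero
      (fun t => (hDm t).aestronglyMeasurable) aestronglyMeasurable_zero ?_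
    simp only [sub_zero]
    rwa [← ENNReal.tendsto_toReal_iff (fun t => (hDmem t).eLpNorm_ne_top) ENNReal.zero_ne_top,
      ENNReal.toReal_zero]
  have hshift := hZ.continuous_comp (g := fun v : Fin n → ℝ => v + fun _ => σ) (by fun_prop)
  refine ⟨_, tendstoInDistribution_of_tendstoInMeasure_sub X _ hshift ?_
    fun t => (h.measurable t).aemeasurable⟩
  have hXD : (X - fun t => (fun v : Fin n → ℝ => v + fun _ => σ) ∘ Y t) = D := by
    funext t ω
    simp only [hD, Pi.sub_apply, Function.comp_apply]
    abel
  rwa [hXD]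

/-- The learning process with the same noise that starts in the true state. -/
noncomputable def learningFromTruth (A : ℕ → Matrix (Fin n) (Fin n) ℝ) (ε : ℕ → Fin n → ℝ) (σ : ℝ)
    (γ : ℕ → Ω → Fin n → ℝ) : ℕ → Ω → Fin n → ℝ
  | 0, _ => fun _ => σ
  | t + 1, ω => (A (t + 1)).mulVec (learningFromTruth A ε σ γ t ω) +
    (Matrix.diagonal (ε (t + 1))).mulVec
      ((fun _ => σ) + γ (t + 1) ω - learningFromTruth A ε σ γ t ω)

theorem IsNoisyLearning.learningFromTruth (h : IsNoisyLearning A ε σ γ X) :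
    IsNoisyLearning A ε σ γ (learningFromTruth A ε σ γ) where
  stochastic := h.stochastic
  measurable_initial := measurable_const
  measurable_noise := h.measurable_noise
  recursion _ _ := rfl

theorem IsNoisyLearning.sub_of_same_noise {X' : ℕ → Ω → Fin n → ℝ}
    (h : IsNoisyLearning A ε σ γ X) (h' : IsNoisyLearning A ε σ γ X') :
    IsNoisyLearning A ε 0 (fun _ _ => 0) (X - X') where
  stochastic := h.stochastic
  measurable_initial := h.measurable_initial.sub h'.measurable_initial
  measurable_noise _ _ := measurable_const
  recursion t ω := by
    simp only [Pi.sub_apply, h.recursion, h'.recursion, Matrix.mulVec_sub, Matrix.mulVec_add]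
    simp only [← Pi.zero_def, Matrix.mulVec_zero]
    abel

theorem IsNoisyLearning.convergesInDistribution (h : IsNoisyLearning A ε σ γ X)
    (hb : BoundedContraction A ε) (hγ : IsIIDIntegrable P γ) (hv : SummableVariation A ε) :
    ConvergesInDistribution P X := by
  obtain ⟨Z, hZ⟩ := h.learningFromTruth.convergesInDistribution_of_initial_eq hb hγ hv
    fun _ => rfl
  have hdiff := h.sub_of_same_noise h.learningFromTruth
  -- The difference is a noiseless process with true state 0 and tends to 0 on every path; no moment
  -- of `X 0` is needed.
  have hlim : TendstoInMeasure P (X - _root_.learningFromTruth A ε σ γ) atTop 0 :=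
    tendstoInMeasure_of_tendsto_ae (fun t => (hdiff.measurable t).aestronglyMeasurable)
      (Eventually.of_forall fun ω => hdiff.tendsto_of_tendsto hb tendsto_const_nhds)
  have hX := tendstoInDistribution_of_tendstoInMeasure_sub X Z hZ hlim
    fun t => (h.measurable t).aemeasurable
  let ν : ProbabilityMeasure (Fin n → ℝ) :=
    ⟨P.map Z, Measure.isProbabilityMeasure_map hX.aemeasurable_limit⟩
  refine ⟨ν, hX.forall_aemeasurable, aemeasurable_id, ?_⟩
  have hν : (⟨(ν : Measure (Fin n → ℝ)).map id,
      Measure.isProbabilityMeasure_map aemeasurable_id⟩ : ProbabilityMeasure (Fin n → ℝ)) = ν :=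
    Subtype.ext Measure.map_id
  rw [hν]
  exact hX.tendsto

end Distribution

theorem mainTheorem1 {n : ℕ} (hn : 1 ≤ n) :
    (∀ {Ω : Type u} [MeasurableSpace Ω] (P : Measure Ω) [IsProbabilityMeasure P]
        (A : ℕ → Matrix (Fin n) (Fin n) ℝ) (ε : ℕ → Fin n → ℝ) (σ : ℝ)
        (γ X : ℕ → Ω → Fin n → ℝ),
        IsNoisyLearning A ε σ γ X → BoundedContraction A ε →
        -- almost sure convergence
        ((∀ᵐ ω ∂P, Tendsto (fun t => γ t ω) atTop (𝓝 0)) →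
          ∀ᵐ ω ∂P, Tendsto (fun t => X t ω) atTop (𝓝 fun _ => σ)) ∧
        -- convergence in probability
        (TendstoInMeasure P γ atTop (fun _ => 0) →
          (∀ᵐ ω ∂P, BddAbove (range fun t : ℕ => ‖γ (t + 1) ω‖)) →
          TendstoInMeasure P X atTop (fun _ _ => σ)) ∧
        -- convergence in `L^p`
        (∀ p : ENNReal, 1 ≤ p → MemLp (X 0) p P → (∀ t, 1 ≤ t → MemLp (γ t) p P) →
          Tendsto (fun t => eLpNorm (γ t) p P) atTop (𝓝 0) →
          (∀ t, MemLp (X t) p P) ∧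
            Tendsto (fun t => eLpNorm (fun ω => X t ω - fun _ => σ) p P) atTop (𝓝 0)) ∧
        -- convergence in distribution
        (IsIIDIntegrable P γ → SummableVariation A ε → ConvergesInDistribution P X)) ∧
    -- failure of convergence in distribution without summable variation
    (∃ (A : ℕ → Matrix (Fin n) (Fin n) ℝ) (ε : ℕ → Fin n → ℝ),
        (∀ t, 1 ≤ t → A t ∈ Matrix.rowStochastic ℝ (Fin n)) ∧
        BoundedContraction A ε ∧ ¬ SummableVariation A ε ∧
        ∀ {Ω : Type u} [MeasurableSpace Ω] (P : Measure Ω) [IsProbabilityMeasure P] (σ : ℝ)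
          (γ X : ℕ → Ω → Fin n → ℝ),
          IsNoisyLearning A ε σ γ X → IsIIDIntegrable P γ →
          (¬ ∃ c : Fin n → ℝ, ∀ᵐ ω ∂P, γ 1 ω = c) →
          ¬ ConvergesInDistribution P X) := by
  refine ⟨fun P _ A ε σ γ X h hb => ⟨fun hγ => ?_, h.tendstoInMeasure hb, fun p hp hX hγ =>
    h.tendsto_eLpNorm hb hp hX hγ, h.convergesInDistribution hb⟩, fun _ => 1, oscillatingRate n,
    fun _ _ => one_mem _, boundedContraction_oscillatingRate hn,
    not_summableVariation_oscillatingRate hn, fun P _ σ γ X h hγ hc =>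
      not_convergesInDistribution_oscillatingRate h hγ hc⟩
  filter_upwards [hγ] with ω hω using h.tendsto_of_tendsto hb hω
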